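/- Throughout, $\mathbb N=\{1,2,\dots\}$, and $X$ is a real Banach space with a Schauder basis $(e_i)_{i\ge1}$. For finite $F,G\subset\mathbb N$, $F<G$ means that $k<l$ for all $k\in F$, $l\in G$, and $n\le F$ means that $n\le k$ for all $k\in F$. For every limit ordinal $\alpha<\omega_1$ fix a strictly increasing sequence $(\alpha_n)_{n\ge1}$ of ordinals with limit $\alpha$. The Schreier families are $S_0=\{\emptyset\}\cup\{\{n\}:n\in\mathbb N\}$; $S_{\alpha+1}=\{\bigcup_{i=1}^nF_i: n\in\mathbb N,\ F_i\in S_\alpha,\ n\le F_i \text{ for all } i,\ F_i<F_j \text{ for } i<j\}$; and $S_\alpha=\{F: n\le F\in S_{\alpha_n}\text{ for some }n\in\mathbb N\}$ for a limit ordinal $\alpha$. A (finite or infinite) sequence $(y_i)$ is a block basis of $(x_i)$, written $(y_i)\prec(x_i)$, if all $y_i\ne0$ and $y_i=\sum_{j=m_i}^{m_{i+1}-1}t_jx_j$ for some integers $1\le m_1<m_2<\cdots$ and reals $t_j$. For $(x_i)$ a block basis of $(e_i)$ and $y\in\operatorname{span}(x_i)$, $\operatorname{ran}(y)$ with respect to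 $(x_i)$ is the smallest interval of $\mathbb N$ that contains the support of the coefficients of $y$ in $(x_i)$. For $\alpha<\omega_1$, a finite sequence of non-zero vectors $(y_i)_1^\ell$ is $\alpha$-admissible with respect to $(x_i)$ if $\operatorname{ran}(y_1)<\cdots<\operatorname{ran}(y_\ell)$ and $\{\min\operatorname{ran}(y_i):i\le\ell\}\in S_\alpha$, ranges being with respect to $(x_i)$. For $(x_i)\prec(e_i)$ put $$\delta_\alpha((x_i),(e_i))=\sup\Big\{\delta\ge0:\Big\|\sum_1^\ell y_i\Big\|\ge\delta\sum_1^\ell\|y_i\|\text{ whenever }(y_i)_1^\ell\prec(x_i)\text{ is }\alpha\text{-admissible with respect to }(e_i)\Big\},$$ and let $\delta_\alpha(x_i)=\delta_\alpha((x_i),(x_i))$ be the same supremum with admissibility taken with respect to $(x_i)$ itself. Let $(y_i)\prec(e_i)$ and let $\gamma=(\gamma_\alpha)_{\alpha<\omega_1}$ be a family of reals. Say that $(y_i)$ $\Delta$-stabilizes $\gamma$ if there is a sequence $\varepsilon_n\searrow0$ such that for every $\alpha<\omega_1$ there is $m\in\mathbb N$ such that $|\delta_\alpha(z_i)-\gamma_\alpha|<\varepsilon_n$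 for all $n\ge m$ and all infinite $(z_i)\prec(y_i)_{i\ge n}$. Say that $(y_i)$ $\Delta_{(e_i)}$-stabilizes $\gamma$ if the same holds with $\delta_\alpha((z_i),(e_i))$ in place of $\delta_\alpha(z_i)$. Let $\Delta(X)$ (respectively $\Delta(X,(e_i))$) be the set of all $\gamma$ that are $\Delta$-stabilized (respectively $\Delta_{(e_i)}$-stabilized) by some infinite block basis $(y_i)\prec(e_i)$. **Theorem.** Let $X$ be a real Banach space with a basis $(e_i)$, and let $(x_i)\prec(e_i)$ be an infinite block basis that $\Delta_{(e_i)}$-stabilizes $\bar\gamma$ and $\Delta$-stabilizes $\gamma$. Then $\bar\gamma=\gamma$. Moreover, $\Delta(X)=\Delta(X,(e_i))$. -/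

import Mathlib

open scoped Ordinal

noncomputable section

namespace DeltaSpectra

/-- A choice, for every countable limit ordinal `α`, of a strictly increasing sequence of ordinals
`α₁ < α₂ < ⋯ < α` with limit `α`.  Here `a α n` is the `(n + 1)`-st term of the sequence. -/
def IsFundamentalSystem (a : Ordinal.{0} → ℕ → Ordinal.{0}) : Prop :=
  ∀ α : Ordinal.{0}, α < ω₁ → Order.IsSuccLimit α →
    StrictMono (a α) ∧ (∀ n, a α n < α) ∧ ∀ β < α, ∃ n, β < a α n

/-- `Schreier a α F`: the finite set `F` of positive integers belongs to the Schreier family `S_α`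
(built from the choice `a` at limit ordinals).
* `S_0` consists of the empty set and of the singletons;
* `S_{α+1}` consists of the unions `F_1 ∪ ⋯ ∪ F_n` with `n ≥ 1`, `n ≤ F_1 < ⋯ < F_n`, `F_i ∈ S_α`
  (some `F_i` may be empty, in which case the inequalities are required of all the others);
* for a limit `α`, `S_α` consists of the `F` with `n ≤ F ∈ S_{α_n}` for some `n ≥ 1`. -/
inductive Schreier (a : Ordinal.{0} → ℕ → Ordinal.{0}) : Ordinal.{0} → Finset ℕ → Prop
  | zero_empty : Schreier a 0 ∅
  | zero_singleton (n : ℕ) (hn : 1 ≤ n) : Schreier a 0 {n}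
  | succ (α : Ordinal.{0}) (n : ℕ) (hn : 1 ≤ n) (F : Fin n → Finset ℕ)
      (hF : ∀ i, Schreier a α (F i))
      (hmin : ∀ i, ∀ k ∈ F i, n ≤ k)
      (hlt : ∀ i j, i < j → ∀ k ∈ F i, ∀ l ∈ F j, k < l) :
      Schreier a (Order.succ α) (Finset.univ.biUnion F)
  | limit (α : Ordinal.{0}) (hα : Order.IsSuccLimit α) (n : ℕ) (F : Finset ℕ)
      (hF : Schreier a (a α n) F) (hmin : ∀ k ∈ F, n + 1 ≤ k) :
      Schreier a α F

/-- A finite sequence `E_1, …, E_ℓ` of non-empty sets of positive integers is `α`-admissible if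
`E_1 < ⋯ < E_ℓ` and `{min E_1, …, min E_ℓ} ∈ S_α`. -/
def IsAdmissibleSets (a : Ordinal.{0} → ℕ → Ordinal.{0}) (α : Ordinal.{0}) {ℓ : ℕ}
    (E : Fin ℓ → Set ℕ) : Prop :=
  (∀ i, (E i).Nonempty) ∧ (∀ i j, i < j → ∀ k ∈ E i, ∀ l ∈ E j, k < l) ∧
    Schreier a α (Finset.univ.image fun i => sInf (E i))

/-- The range of a finitely supported sequence of coefficients: the smallest interval of positive
integers that contains its support.  Sequences are indexed by `0, 1, 2, …` in Lean, and the term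
with index `i` is the `(i + 1)`-st term of the sequence, whence the shift. -/
def ran (c : ℕ →₀ ℝ) : Set ℕ :=
  {k | ∃ i ∈ c.support, ∃ j ∈ c.support, i + 1 ≤ k ∧ k ≤ j + 1}

variable {X : Type*} [NormedAddCommGroup X] [NormedSpace ℝ X]

/-- `y_1, …, y_ℓ` is `α`-admissible with respect to `(e_i)`: the `y_i` are finite linear
combinations of `(e_i)` whose ranges with respect to `(e_i)` form an `α`-admissible sequence.
(The coefficients are unique when `(e_i)` is a basic sequence.) -/
def IsAdmissible (a : Ordinal.{0} → ℕ → Ordinal.{0}) (α : Ordinal.{0}) (e : ℕ → X) {ℓ : ℕ}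
    (y : Fin ℓ → X) : Prop :=
  ∃ c : Fin ℓ → ℕ →₀ ℝ, (∀ i, y i = Finsupp.linearCombination ℝ e (c i)) ∧
    IsAdmissibleSets a α fun i => ran (c i)

/-- `(y_i) ≺ (x_i)`: the infinite sequence `(y_i)` is a block basis of `(x_i)`. -/
def IsBlockBasis (x y : ℕ → X) : Prop :=
  ∃ (m : ℕ → ℕ) (t : ℕ → ℝ), StrictMono m ∧
    ∀ i, y i = ∑ j ∈ Finset.Ico (m i) (m (i + 1)), t j • x j ∧ y i ≠ 0

/-- `(y_i)_1^ℓ ≺ (x_i)`: the finite sequence `y_1, …, y_ℓ` is a block basis of `(x_i)`. -/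
def IsFiniteBlockBasis (x : ℕ → X) {ℓ : ℕ} (y : Fin ℓ → X) : Prop :=
  ∃ (m : Fin (ℓ + 1) → ℕ) (t : ℕ → ℝ), StrictMono m ∧
    ∀ i : Fin ℓ, y i = ∑ j ∈ Finset.Ico (m i.castSucc) (m i.succ), t j • x j ∧ y i ≠ 0

/-- The constant `δ_α((x_i), (e_i))`. -/
def deltaRel (a : Ordinal.{0} → ℕ → Ordinal.{0}) (α : Ordinal.{0}) (x e : ℕ → X) : ℝ :=
  sSup {δ : ℝ | 0 ≤ δ ∧ ∀ (ℓ : ℕ) (y : Fin ℓ → X), IsFiniteBlockBasis x y →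
    IsAdmissible a α e y → δ * ∑ i, ‖y i‖ ≤ ‖∑ i, y i‖}

/-- The constant `δ_α(x_i)`, in which `(x_i)` itself is the frame of reference. -/
def delta (a : Ordinal.{0} → ℕ → Ordinal.{0}) (α : Ordinal.{0}) (x : ℕ → X) : ℝ :=
  deltaRel a α x x

/-- `(y_i)` `Δ`-stabilizes `γ = (γ_α)_{α < ω₁}`. -/
def Stabilizes (a : Ordinal.{0} → ℕ → Ordinal.{0}) (y : ℕ → X)
    (γ : Set.Iio (ω₁ : Ordinal.{0}) → ℝ) : Prop :=
  ∃ ε : ℕ → ℝ, Antitone ε ∧ Filter.Tendsto ε Filter.atTop (nhds 0) ∧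
    ∀ α : Set.Iio (ω₁ : Ordinal.{0}), ∃ m : ℕ, ∀ n ≥ m, ∀ z : ℕ → X,
      IsBlockBasis (fun i => y (n + i)) z → |delta a α z - γ α| < ε n

/-- `(y_i)`, a block basis of `(e_i)`, `Δ_{(e_i)}`-stabilizes `γ = (γ_α)_{α < ω₁}`. -/
def StabilizesRel (a : Ordinal.{0} → ℕ → Ordinal.{0}) (e y : ℕ → X)
    (γ : Set.Iio (ω₁ : Ordinal.{0}) → ℝ) : Prop :=
  IsBlockBasis e y ∧
  ∃ ε : ℕ → ℝ, Antitone ε ∧ Filter.Tendsto ε Filter.atTop (nhds 0) ∧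
    ∀ α : Set.Iio (ω₁ : Ordinal.{0}), ∃ m : ℕ, ∀ n ≥ m, ∀ z : ℕ → X,
      IsBlockBasis (fun i => y (n + i)) z → |deltaRel a α z e - γ α| < ε n

/-- The `Δ`-spectrum `Δ(X)` of the space `X` with basis `(e_i)`. -/
def spectrum (a : Ordinal.{0} → ℕ → Ordinal.{0}) (e : ℕ → X) :
    Set (Set.Iio (ω₁ : Ordinal.{0}) → ℝ) :=
  {γ | ∃ y : ℕ → X, IsBlockBasis e y ∧ Stabilizes a y γ}

/-- The `Δ`-spectrum `Δ(X, (e_i))`, with the basis `(e_i)` kept as the frame of reference. -/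
def spectrumRel (a : Ordinal.{0} → ℕ → Ordinal.{0}) (e : ℕ → X) :
    Set (Set.Iio (ω₁ : Ordinal.{0}) → ℝ) :=
  {γ | ∃ y : ℕ → X, StabilizesRel a e y γ}

end DeltaSpectra

end

/-! A block vector moves to the right when its coordinates are taken in `e` instead of a block basis
`x`. Schreier families are spreading, so admissibility with respect to `x` implies admissibility
with respect to `e`, whence `deltaRel a α x e ≤ delta a α x` (`deltaRel_le_delta`).

The converse inequality holds up to small errors after passing to a further block basis
(`IsBlockBasis.exists_block_delta_le`). Take z_k = s_k x_{u_k} + x_{J_k} with s_k tiny and J_k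
beyond the whole `e`-support of x_{u_k}. In `e`, a block of (z_k) begins where its first x_{u_k}
does; deleting the terms s_k x_{u_k} changes it little, and the new vector begins, in
`x`-coordinates, at some J_k, which is further right. By spreading, `e`-admissible blocks of (z_k)
thus become `x`-admissible ones. The choice of z does not depend on α, so all countable ordinals are
treated at once.

Consequently a sequence stabilizing relative to `e` stabilizes the same family relative to itself:
the upper bound comes from such a z inside each block basis and from monotonicity of `delta` under
blocking. Uniqueness of the stabilized family gives the first claim. Conversely, if x stabilizes
relative to itself, then z stabilizes relative to `e`, which gives the equality of spectra. -/

/-! ### Coefficient vectors of block sequences -/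

/-- Coefficient vectors supported in pairwise disjoint intervals come from one scalar sequence. -/
theorem exists_common_coeff {ι : Type*} (I : ι → Finset ℕ)
    (hI : ∀ i j, ∀ k ∈ I i, k ∈ I j → i = j) (b : ι → ℕ →₀ ℝ) :
    ∃ t : ℕ → ℝ, ∀ i, ∀ k ∈ I i, t k = b i k := by
  classical
  refine ⟨fun k => if h : ∃ i, k ∈ I i then b h.choose k else 0, fun i k hk => ?_⟩
  have h : ∃ i, k ∈ I i := ⟨i, hk⟩
  have := hI _ _ k h.choose_spec hk
  simp only [dif_pos h, this]

theorem linearCombination_eq_sum {X : Type*} [NormedAddCommGroup X] [NormedSpace ℝ X] (x : ℕ → X)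
    {b : ℕ →₀ ℝ} {S : Finset ℕ} (hb : b.support ⊆ S) {t : ℕ → ℝ} (ht : ∀ k ∈ S, t k = b k) :
    Finsupp.linearCombination ℝ x b = ∑ k ∈ S, t k • x k := by
  rw [Finsupp.linearCombination_apply_of_mem_supported ℝ (s := S)]
  · exact Finset.sum_congr rfl fun k hk => by rw [ht k hk]
  · rw [Finsupp.mem_supported]; exact_mod_cast hb

theorem exists_finsupp_of_sum {X : Type*} [NormedAddCommGroup X] [NormedSpace ℝ X] (x : ℕ → X)
    (S : Finset ℕ) (t : ℕ → ℝ) :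
    ∃ b : ℕ →₀ ℝ, b.support ⊆ S ∧ ∑ k ∈ S, t k • x k = Finsupp.linearCombination ℝ x b := by
  classical
  refine ⟨Finsupp.onFinset S (fun k => if k ∈ S then t k else 0) (by aesop), by simp, ?_⟩
  refine (linearCombination_eq_sum x (S := S) (by simp) fun k hk => ?_).symm
  simp [hk]

/-- The vectors `B 0, B 1, …` are supported in the successive intervals `[m k, m (k + 1))`. -/
def IsBlockCoeff (m : ℕ → ℕ) (B : ℕ → ℕ →₀ ℝ) : Prop :=
  StrictMono m ∧ ∀ k, (B k).support ⊆ Finset.Ico (m k) (m (k + 1))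

theorem Ico_unique {m : ℕ → ℕ} (hm : StrictMono m) {i j k : ℕ}
    (hi : k ∈ Finset.Ico (m i) (m (i + 1))) (hj : k ∈ Finset.Ico (m j) (m (j + 1))) : i = j := by
  simp only [Finset.mem_Ico] at hi hj
  rcases lt_trichotomy i j with h | h | h
  · have := hm.monotone (Nat.succ_le_of_lt h); simp only [Nat.succ_eq_add_one] at this; omega
  · exact h
  · have := hm.monotone (Nat.succ_le_of_lt h); simp only [Nat.succ_eq_add_one] at this; omega

theorem fin_succ_le_castSucc {ℓ : ℕ} {m : Fin (ℓ + 1) → ℕ} (hm : StrictMono m) {i j : Fin ℓ}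
    (h : i < j) : m i.succ ≤ m j.castSucc :=
  hm.monotone (by simp only [Fin.le_def, Fin.val_succ, Fin.val_castSucc, Fin.lt_def] at *; omega)

/-- The supports of the `B k` are disjoint, so at each coordinate at most one term is non-zero and
nothing cancels. -/
theorem IsBlockCoeff.mem_support_iff {m : ℕ → ℕ} {B : ℕ → ℕ →₀ ℝ} (hB : IsBlockCoeff m B)
    (c : ℕ →₀ ℝ) (r : ℕ) :
    r ∈ (Finsupp.linearCombination ℝ B c).support ↔ ∃ k ∈ c.support, r ∈ (B k).support := by
  have key : ∀ k, r ∈ (B k).support → Finsupp.linearCombination ℝ B c r = c k * B k r := by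
    intro k hk
    rw [Finsupp.linearCombination_apply, Finsupp.sum, Finsupp.finsetSum_apply]
    simp only [Finsupp.smul_apply, smul_eq_mul]
    refine Finset.sum_eq_single k (fun j _ hj => ?_) (fun h => ?_)
    · by_contra h
      have hr : r ∈ (B j).support := by
        rw [Finsupp.mem_support_iff]; exact fun h' => h (by rw [h', mul_zero])
      exact hj (Ico_unique hB.1 (hB.2 j hr) (hB.2 k hk))
    · rw [Finsupp.notMem_support_iff.1 h, zero_mul]
  constructor
  · intro h
    by_contra! hc
    rw [Finsupp.mem_support_iff, Finsupp.linearCombination_apply, Finsupp.sum,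
      Finsupp.finsetSum_apply] at h
    refine h (Finset.sum_eq_zero fun k hk => ?_)
    have := hc k hk
    rw [Finsupp.notMem_support_iff] at this
    simp [this]
  · rintro ⟨k, hk, hr⟩
    rw [Finsupp.mem_support_iff, key k hr]
    exact mul_ne_zero (Finsupp.mem_support_iff.1 hk) (Finsupp.mem_support_iff.1 hr)

theorem IsBlockCoeff.support_subset {m : ℕ → ℕ} {B : ℕ → ℕ →₀ ℝ} (hB : IsBlockCoeff m B)
    {c : ℕ →₀ ℝ} {p q : ℕ} (hc : c.support ⊆ Finset.Ico p q) :
    (Finsupp.linearCombination ℝ B c).support ⊆ Finset.Ico (m p) (m q) := by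
  intro r hr
  obtain ⟨k, hk, hrk⟩ := (hB.mem_support_iff c r).1 hr
  have h1 := Finset.mem_Ico.1 (hc hk)
  have h2 := Finset.mem_Ico.1 (hB.2 k hrk)
  have h3 := hB.1.monotone h1.1
  have h4 := hB.1.monotone (Nat.succ_le_of_lt h1.2)
  simp only [Nat.succ_eq_add_one] at h4
  exact Finset.mem_Ico.2 ⟨by omega, by omega⟩

theorem IsBlockCoeff.comp {m m' : ℕ → ℕ} {B C : ℕ → ℕ →₀ ℝ} (hB : IsBlockCoeff m B)
    (hC : IsBlockCoeff m' C) :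
    IsBlockCoeff (m ∘ m') fun k => Finsupp.linearCombination ℝ B (C k) :=
  ⟨hB.1.comp hC.1, fun k => hB.support_subset (hC.2 k)⟩

namespace DeltaSpectra

/-! ### Schreier families and admissible ranges -/

section Schreier

variable {a : Ordinal.{0} → ℕ → Ordinal.{0}} {α : Ordinal.{0}}

/-- Schreier families are spreading. -/
theorem Schreier.image {F : Finset ℕ} (hF : Schreier a α F) (φ : ℕ → ℕ)
    (hle : ∀ k ∈ F, k ≤ φ k) (hmono : ∀ k ∈ F, ∀ l ∈ F, k < l → φ k < φ l) :
    Schreier a α (F.image φ) := by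
  induction hF with
  | zero_empty => simpa using Schreier.zero_empty
  | zero_singleton n hn =>
    rw [Finset.image_singleton]
    exact Schreier.zero_singleton _ (hn.trans (hle n (by simp)))
  | succ α n hn F hF hmin hlt ih =>
    have hsub : ∀ i, ∀ k ∈ F i, k ∈ Finset.univ.biUnion F := fun i k hk =>
      Finset.mem_biUnion.2 ⟨i, Finset.mem_univ _, hk⟩
    rw [Finset.biUnion_image]
    refine Schreier.succ α n hn (fun i => (F i).image φ) (fun i => ih i
      (fun k hk => hle k (hsub i k hk))
      fun k hk l hl => hmono k (hsub i k hk) l (hsub i l hl)) ?_ ?_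
    · intro i k hk
      obtain ⟨k, hk', rfl⟩ := Finset.mem_image.1 hk
      exact (hmin i k hk').trans (hle k (hsub i k hk'))
    · intro i j hij k hk l hl
      obtain ⟨k, hk', rfl⟩ := Finset.mem_image.1 hk
      obtain ⟨l, hl', rfl⟩ := Finset.mem_image.1 hl
      exact hmono k (hsub i k hk') l (hsub j l hl') (hlt i j hij k hk' l hl')
  | limit α hα n F hF hmin ih =>
    refine Schreier.limit α hα n _ (ih hle hmono) fun k hk => ?_
    obtain ⟨k, hk', rfl⟩ := Finset.mem_image.1 hk
    exact (hmin k hk').trans (hle k hk')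

theorem Schreier.image_of_le {ℓ : ℕ} {f g : Fin ℓ → ℕ}
    (hS : Schreier a α (Finset.univ.image f)) (hf : StrictMono f) (hg : StrictMono g)
    (hfg : ∀ i, f i ≤ g i) : Schreier a α (Finset.univ.image g) := by
  -- The map f i ↦ g i is extended to all of ℕ; its values off the range of f play no role.
  have hext : ∀ i, Function.extend f g id (f i) = g i := hf.injective.extend_apply g id
  have := hS.image (Function.extend f g id)
    (by simp only [Finset.mem_image, Finset.mem_univ, true_and, forall_exists_index,
          forall_apply_eq_imp_iff, hext]; exact hfg)
    (by simp only [Finset.mem_image, Finset.mem_univ, true_and, forall_exists_index,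
          forall_apply_eq_imp_iff, hext, hf.lt_iff_lt]; exact fun i j h => hg h)
  rw [Finset.image_image] at this
  convert this using 2
  ext i
  simp [hext]

theorem Schreier.singleton (ha : IsFundamentalSystem a) (hα : α < Ordinal.omega 1) {k : ℕ}
    (hk : 1 ≤ k) : Schreier a α {k} := by
  induction α using Ordinal.limitRecOn with
  | zero => exact Schreier.zero_singleton k hk
  | add_one β ih =>
    rw [← Order.succ_eq_add_one] at hα ⊢
    have h := Schreier.succ β 1 le_rfl (fun _ => {k}) (a := a)
      (fun _ => ih ((Order.lt_succ β).trans hα)) (by simpa using hk)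
      (fun i j hij => absurd hij (by simp [Subsingleton.elim i j]))
    simpa using h
  | limit β hβ ih =>
    have h := ha β hα hβ
    exact Schreier.limit β hβ 0 _ (ih _ (h.2.1 0) ((h.2.1 0).trans hα)) (by simpa using hk)

theorem sInf_ran_le {c : ℕ →₀ ℝ} {p : ℕ} (hp : p ∈ c.support) : sInf (ran c) ≤ p + 1 :=
  Nat.sInf_le ⟨p, hp, p, hp, le_rfl, le_rfl⟩

theorem ran_nonempty {c : ℕ →₀ ℝ} (hc : c ≠ 0) : (ran c).Nonempty := by
  obtain ⟨p, hp⟩ := Finsupp.support_nonempty_iff.2 hc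
  exact ⟨p + 1, p, hp, p, hp, le_rfl, le_rfl⟩

theorem exists_sInf_ran_eq {c : ℕ →₀ ℝ} (hc : c ≠ 0) : ∃ p ∈ c.support, p + 1 ≤ sInf (ran c) := by
  obtain ⟨p, hp, _, _, h, _⟩ := Nat.sInf_mem (ran_nonempty hc)
  exact ⟨p, hp, h⟩

/-- Admissibility of ranges passes to successive vectors whose supports lie further to the
right. -/
theorem IsAdmissibleSets.of_dominated {ℓ : ℕ} {c c' : Fin ℓ → ℕ →₀ ℝ}
    (h : IsAdmissibleSets a α fun i => ran (c i)) (hne : ∀ i, c' i ≠ 0)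
    (hlt : ∀ i j, i < j → ∀ p ∈ (c' i).support, ∀ q ∈ (c' j).support, p < q)
    (hdom : ∀ i, ∀ q ∈ (c' i).support, ∃ p ∈ (c i).support, p ≤ q) :
    IsAdmissibleSets a α fun i => ran (c' i) := by
  have hr : ∀ i j, i < j → ∀ k ∈ ran (c' i), ∀ l ∈ ran (c' j), k < l := by
    rintro i j hij k ⟨_, _, p, hp, _, hkp⟩ l ⟨q, hq, _, _, hql, _⟩
    have := hlt i j hij p hp q hq
    omega
  refine ⟨fun i => ran_nonempty (hne i), hr, h.2.2.image_of_le ?_ ?_ ?_⟩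
  · exact fun i j hij => h.2.1 i j hij _ (Nat.sInf_mem (h.1 i)) _ (Nat.sInf_mem (h.1 j))
  · exact fun i j hij => hr i j hij _ (Nat.sInf_mem (ran_nonempty (hne i))) _
      (Nat.sInf_mem (ran_nonempty (hne j)))
  · intro i
    obtain ⟨q, hq, hqr⟩ := exists_sInf_ran_eq (hne i)
    obtain ⟨p, hp, hpq⟩ := hdom i q hq
    have := sInf_ran_le hp
    show sInf (ran (c i)) ≤ sInf (ran (c' i))
    omega

end Schreier

/-! ### Block bases in terms of coefficient vectors -/

section Blocks

variable {X : Type*} [NormedAddCommGroup X] [NormedSpace ℝ X] {x y z : ℕ → X}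

theorem isBlockBasis_iff : IsBlockBasis x y ↔ ∃ m B, IsBlockCoeff m B ∧
    ∀ k, y k = Finsupp.linearCombination ℝ x (B k) ∧ y k ≠ 0 := by
  constructor
  · rintro ⟨m, t, hm, h⟩
    choose B hB hB' using fun k => exists_finsupp_of_sum x (Finset.Ico (m k) (m (k + 1))) t
    exact ⟨m, B, ⟨hm, hB⟩, fun k => ⟨(h k).1.trans (hB' k), (h k).2⟩⟩
  · rintro ⟨m, B, hB, h⟩
    obtain ⟨t, ht⟩ := exists_common_coeff (fun k => Finset.Ico (m k) (m (k + 1)))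
      (fun i j k => Ico_unique hB.1) B
    exact ⟨m, t, hB.1, fun k =>
      ⟨(h k).1.trans (linearCombination_eq_sum x (hB.2 k) (ht k)), (h k).2⟩⟩

theorem isFiniteBlockBasis_iff {ℓ : ℕ} {y : Fin ℓ → X} : IsFiniteBlockBasis x y ↔
    ∃ (m : Fin (ℓ + 1) → ℕ) (b : Fin ℓ → ℕ →₀ ℝ), StrictMono m ∧
      (∀ i, (b i).support ⊆ Finset.Ico (m i.castSucc) (m i.succ)) ∧
      ∀ i, y i = Finsupp.linearCombination ℝ x (b i) ∧ y i ≠ 0 := by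
  constructor
  · rintro ⟨m, t, hm, h⟩
    choose b hb hb' using fun i : Fin ℓ =>
      exists_finsupp_of_sum x (Finset.Ico (m i.castSucc) (m i.succ)) t
    exact ⟨m, b, hm, hb, fun i => ⟨(h i).1.trans (hb' i), (h i).2⟩⟩
  · rintro ⟨m, b, hm, hb, h⟩
    obtain ⟨t, ht⟩ := exists_common_coeff (fun i : Fin ℓ => Finset.Ico (m i.castSucc) (m i.succ))
      (fun i j k hi hj => by
        rw [Finset.mem_Ico] at hi hj
        rcases lt_trichotomy i j with h | h | h
        · have := fin_succ_le_castSucc hm h; omega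
        · exact h
        · have := fin_succ_le_castSucc hm h; omega) b
    exact ⟨m, t, hm, fun i =>
      ⟨(h i).1.trans (linearCombination_eq_sum x (hb i) (ht i)), (h i).2⟩⟩

theorem IsBlockBasis.ne_zero (h : IsBlockBasis x y) (k : ℕ) : y k ≠ 0 := by
  obtain ⟨_, _, _, h⟩ := h
  exact (h k).2

theorem linearCombination_blocks {B : ℕ → ℕ →₀ ℝ}
    (h : ∀ k, y k = Finsupp.linearCombination ℝ x (B k)) (c : ℕ →₀ ℝ) :
    Finsupp.linearCombination ℝ y c =
      Finsupp.linearCombination ℝ x (Finsupp.linearCombination ℝ B c) := by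
  rw [Finsupp.linearCombination_linearCombination, funext h]

theorem IsBlockBasis.trans (hxy : IsBlockBasis x y) (hyz : IsBlockBasis y z) :
    IsBlockBasis x z := by
  obtain ⟨m, B, hB, h⟩ := isBlockBasis_iff.1 hxy
  obtain ⟨m', C, hC, h'⟩ := isBlockBasis_iff.1 hyz
  exact isBlockBasis_iff.2 ⟨_, _, hB.comp hC, fun k =>
    ⟨(h' k).1.trans (linearCombination_blocks (fun k => (h k).1) _), (h' k).2⟩⟩

theorem IsFiniteBlockBasis.of_isBlockBasis {ℓ : ℕ} {w : Fin ℓ → X} (hxy : IsBlockBasis x y)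
    (hw : IsFiniteBlockBasis y w) : IsFiniteBlockBasis x w := by
  obtain ⟨m, B, hB, h⟩ := isBlockBasis_iff.1 hxy
  obtain ⟨m', b, hm', hb, h'⟩ := isFiniteBlockBasis_iff.1 hw
  exact isFiniteBlockBasis_iff.2 ⟨m ∘ m', _, hB.1.comp hm', fun i => hB.support_subset (hb i),
    fun i => ⟨(h' i).1.trans (linearCombination_blocks (fun k => (h k).1) _), (h' i).2⟩⟩

theorem isBlockBasis_tail (hx : ∀ i, x i ≠ 0) (n : ℕ) : IsBlockBasis x fun i => x (n + i) :=
  ⟨fun k => n + k, fun _ => 1, fun i j h => by simpa using h,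
    fun i => ⟨by simp [← add_assoc], hx _⟩⟩

theorem IsBlockBasis.tail (h : IsBlockBasis x y) (n : ℕ) :
    IsBlockBasis (fun i => x (n + i)) fun i => y (n + i) := by
  obtain ⟨m, t, hm, h⟩ := h
  -- This makes the truncated subtractions below genuine ones.
  have hn : ∀ k, n ≤ m (n + k) := fun k => (Nat.le_add_right n k).trans (hm.id_le _)
  refine ⟨fun k => m (n + k) - n, fun i => t (n + i), fun i j hij => ?_, fun i => ?_⟩
  · have h1 := hm (Nat.add_lt_add_left hij n)
    have h2 := hn i
    show m (n + i) - n < m (n + j) - n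
    omega
  · refine ⟨(h (n + i)).1.trans ?_, (h (n + i)).2⟩
    have h1 : n + (m (n + i) - n) = m (n + i) := Nat.add_sub_cancel' (hn i)
    have h2 : n + (m (n + (i + 1)) - n) = m (n + i + 1) := Nat.add_sub_cancel' (hn (i + 1))
    rw [Finset.sum_Ico_add (fun j => t j • x j), add_comm _ n, add_comm _ n, h1, h2]

end Blocks

/-! ### Comparison of the constants -/

section Delta

variable {X : Type*} [NormedAddCommGroup X] [NormedSpace ℝ X] {x e : ℕ → X}
  {a : Ordinal.{0} → ℕ → Ordinal.{0}} {α : Ordinal.{0}}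

theorem deltaRel_nonneg : 0 ≤ deltaRel a α x e := Real.sSup_nonneg fun _ h => h.1

/-- The supremum is itself an admissible constant: each defining inequality is closed in δ, and 0
belongs to the set. -/
theorem deltaRel_mul_le {ℓ : ℕ} {y : Fin ℓ → X} (hy : IsFiniteBlockBasis x y)
    (hya : IsAdmissible a α e y) : deltaRel a α x e * ∑ i, ‖y i‖ ≤ ‖∑ i, y i‖ := by
  rcases (Finset.sum_nonneg fun i _ => norm_nonneg (y i) : 0 ≤ ∑ i, ‖y i‖).eq_or_lt with h | h
  · rw [← h, mul_zero]; exact norm_nonneg _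
  · rw [← le_div_iff₀ h]
    refine csSup_le ⟨0, le_rfl, fun _ _ _ _ => by simp⟩ fun δ hδ => ?_
    rw [le_div_iff₀ h]
    exact hδ.2 _ y hy hya

/-- Tested on the one-term sequence x_0, which is admissible because Schreier families contain the
singletons. This bounds the set in `deltaRel`, whose `sSup` would otherwise default to 0. -/
theorem le_one_of_forall (ha : IsFundamentalSystem a) (hα : α < Ordinal.omega 1)
    (hx : IsBlockBasis e x) {δ : ℝ}
    (h : ∀ (ℓ : ℕ) (y : Fin ℓ → X), IsFiniteBlockBasis x y →
      IsAdmissible a α e y → δ * ∑ i, ‖y i‖ ≤ ‖∑ i, y i‖) : δ ≤ 1 := by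
  have h0 := hx.ne_zero 0
  obtain ⟨m, B, hB, hBx⟩ := isBlockBasis_iff.1 hx
  have hB0 : B 0 ≠ 0 := fun h => h0 (by rw [(hBx 0).1, h, map_zero])
  have := h 1 (fun _ => x 0) ?_ ?_
  · simp only [Finset.univ_unique, Finset.sum_singleton] at this
    exact le_of_mul_le_mul_right (by simpa using this) (norm_pos_iff.2 h0)
  · exact ⟨fun i => i, fun _ => 1, Fin.strictMono_iff_lt_succ.2 (by simp), fun i => ⟨by
      obtain rfl := Subsingleton.elim i 0
      simp, h0⟩⟩
  · refine ⟨fun _ => B 0, fun _ => (hBx 0).1, fun _ => ran_nonempty hB0,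
      fun i j hij => absurd hij (by simp [Subsingleton.elim i j]), ?_⟩
    rw [Finset.image_const Finset.univ_nonempty]
    obtain ⟨p, _, hp⟩ := exists_sInf_ran_eq hB0
    exact Schreier.singleton ha hα (by omega)

theorem le_deltaRel (ha : IsFundamentalSystem a) (hα : α < Ordinal.omega 1)
    (hx : IsBlockBasis e x) {δ : ℝ}
    (h : ∀ (ℓ : ℕ) (y : Fin ℓ → X), IsFiniteBlockBasis x y →
      IsAdmissible a α e y → δ * ∑ i, ‖y i‖ ≤ ‖∑ i, y i‖) : δ ≤ deltaRel a α x e := by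
  rcases le_total δ 0 with h0 | h0
  · exact h0.trans deltaRel_nonneg
  · exact le_csSup ⟨1, fun δ hδ => le_one_of_forall ha hα hx hδ.2⟩ ⟨h0, h⟩

theorem isBlockBasis_self (hx : ∀ i, x i ≠ 0) : IsBlockBasis x x := by
  simpa using isBlockBasis_tail hx 0

theorem delta_le_one (ha : IsFundamentalSystem a) (hα : α < Ordinal.omega 1)
    (hx : ∀ i, x i ≠ 0) : delta a α x ≤ 1 :=
  le_one_of_forall ha hα (isBlockBasis_self hx) fun _ _ => deltaRel_mul_le

/-- Admissibility with respect to a block basis of `(e_i)` implies admissibility with respect to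
`(e_i)`. -/
theorem IsAdmissible.of_isBlockBasis (hx : IsBlockBasis e x) {ℓ : ℕ} {y : Fin ℓ → X}
    (h0 : ∀ i, y i ≠ 0) (hy : IsAdmissible a α x y) : IsAdmissible a α e y := by
  obtain ⟨m, B, hB, hBx⟩ := isBlockBasis_iff.1 hx
  obtain ⟨c, hc, hadm⟩ := hy
  have hcy : ∀ i, y i = Finsupp.linearCombination ℝ e (Finsupp.linearCombination ℝ B (c i)) :=
    fun i => (hc i).trans (linearCombination_blocks (fun k => (hBx k).1) _)
  refine ⟨_, hcy, hadm.of_dominated (fun i h => h0 i (by rw [hcy, h, map_zero])) ?_ ?_⟩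
  · intro i j hij p hp q hq
    obtain ⟨k, hk, hpk⟩ := (hB.mem_support_iff _ _).1 hp
    obtain ⟨l, hl, hql⟩ := (hB.mem_support_iff _ _).1 hq
    have hkl := hadm.2.1 i j hij (k + 1) ⟨k, hk, k, hk, le_rfl, le_rfl⟩
      (l + 1) ⟨l, hl, l, hl, le_rfl, le_rfl⟩
    have h1 := Finset.mem_Ico.1 (hB.2 k hpk)
    have h2 := Finset.mem_Ico.1 (hB.2 l hql)
    have := hB.1.monotone (show k + 1 ≤ l by omega)
    omega
  · intro i q hq
    obtain ⟨k, hk, hqk⟩ := (hB.mem_support_iff _ _).1 hq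
    -- The k-th block starts at m k ≥ k, so supports only move to the right.
    exact ⟨k, hk, (hB.1.id_le k).trans (Finset.mem_Ico.1 (hB.2 k hqk)).1⟩

theorem IsFiniteBlockBasis.ne_zero {ℓ : ℕ} {y : Fin ℓ → X} (h : IsFiniteBlockBasis x y)
    (i : Fin ℓ) : y i ≠ 0 := by
  obtain ⟨_, _, _, h⟩ := h
  exact (h i).2

theorem deltaRel_le_delta (ha : IsFundamentalSystem a) (hα : α < Ordinal.omega 1)
    (hx : IsBlockBasis e x) : deltaRel a α x e ≤ delta a α x :=
  le_deltaRel ha hα (isBlockBasis_self hx.ne_zero) fun _ _ hy hya =>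
    deltaRel_mul_le hy (hya.of_isBlockBasis hx hy.ne_zero)

theorem delta_mono (ha : IsFundamentalSystem a) (hα : α < Ordinal.omega 1) {y : ℕ → X}
    (hx : IsBlockBasis x y) : delta a α x ≤ delta a α y :=
  le_deltaRel ha hα (isBlockBasis_self hx.ne_zero) fun _ _ hy hya =>
    deltaRel_mul_le (hy.of_isBlockBasis hx) (hya.of_isBlockBasis hx hy.ne_zero)

end Delta

end DeltaSpectra

namespace DeltaSpectra

/-! ### Perturbed blocks and transfer between frames -/

section Perturbation

variable {X : Type*} [NormedAddCommGroup X] [NormedSpace ℝ X]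

/-- A block basis of a Schauder basis has continuous biorthogonal functionals. -/
theorem IsBlockBasis.exists_biorthogonal {e : SchauderBasis ℝ X} {x : ℕ → X}
    (hx : IsBlockBasis e x) :
    ∃ f : ℕ → StrongDual ℝ X, ∀ k j, f k (x j) = if k = j then 1 else 0 := by
  obtain ⟨m, B, hB, hBx⟩ := isBlockBasis_iff.1 hx
  have hcoord : ∀ q c, e.coord q (Finsupp.linearCombination ℝ e c) = c q := fun q c => by
    simp [Finsupp.linearCombination_apply, Finsupp.sum, e.ortho, Pi.single_apply, eq_comm]
  have hne : ∀ k, (B k).support.Nonempty := fun k => Finsupp.support_nonempty_iff.2 fun h =>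
    (hBx k).2 (by rw [(hBx k).1, h, map_zero])
  choose q hq using hne
  refine ⟨fun k => (B k (q k))⁻¹ • e.coord (q k), fun k j => ?_⟩
  have hval : ((B k (q k))⁻¹ • e.coord (q k)) (x j) = (B k (q k))⁻¹ * B j (q k) := by
    rw [smul_apply, (hBx j).1, hcoord, smul_eq_mul]
  rw [hval]
  split_ifs with h
  · subst h
    exact inv_mul_cancel₀ (Finsupp.mem_support_iff.1 (hq k))
  · have : B j (q k) = 0 := Finsupp.notMem_support_iff.1 fun h' =>
      h (Ico_unique hB.1 (hB.2 k (hq k)) (hB.2 j h'))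
    rw [this, mul_zero]

/-- Replacing the vectors of a sequence with biorthogonal functionals by very close ones moves
linear combinations only a little. -/
theorem norm_linearCombination_sub_le {z v : ℕ → X} {g : ℕ → StrongDual ℝ X}
    (hg : ∀ k j, g k (z j) = if k = j then 1 else 0) {n : ℕ}
    (h : ∀ k, ‖g k‖ * ‖z k - v k‖ ≤ (1 / 2 : ℝ) ^ (n + 2) * (1 / 2) ^ k) (c : ℕ →₀ ℝ) :
    ‖Finsupp.linearCombination ℝ z c - Finsupp.linearCombination ℝ v c‖ ≤
      (1 / 2 : ℝ) ^ (n + 1) * ‖Finsupp.linearCombination ℝ z c‖ := by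
  set y := Finsupp.linearCombination ℝ z c with hy
  -- The coefficients are recovered from y, so |c k| ≤ ‖g k‖ ‖y‖.
  have hc : ∀ k, g k y = c k := fun k => by
    simp [hy, Finsupp.linearCombination_apply, Finsupp.sum, hg, eq_comm]
  have hsub : y - Finsupp.linearCombination ℝ v c = ∑ k ∈ c.support, c k • (z k - v k) := by
    simp only [hy, Finsupp.linearCombination_apply, Finsupp.sum, smul_sub, Finset.sum_sub_distrib]
  have hgeom : ∑ k ∈ c.support, (1 / 2 : ℝ) ^ k ≤ 2 := by
    have := summable_geometric_two.sum_le_tsum c.support fun _ _ => by positivity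
    rwa [tsum_geometric_two] at this
  rw [hsub]
  calc ‖∑ k ∈ c.support, c k • (z k - v k)‖
      ≤ ∑ k ∈ c.support, ‖c k • (z k - v k)‖ := norm_sum_le _ _
    _ ≤ ∑ k ∈ c.support, ‖y‖ * ((1 / 2 : ℝ) ^ (n + 2) * (1 / 2) ^ k) := by
        refine Finset.sum_le_sum fun k _ => ?_
        rw [norm_smul, ← hc k]
        calc ‖g k y‖ * ‖z k - v k‖ ≤ ‖g k‖ * ‖y‖ * ‖z k - v k‖ := by
              gcongr; exact (g k).le_opNorm y
          _ = ‖y‖ * (‖g k‖ * ‖z k - v k‖) := by ring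
          _ ≤ _ := mul_le_mul_of_nonneg_left (h k) (norm_nonneg y)
    _ = ‖y‖ * (1 / 2 : ℝ) ^ (n + 2) * ∑ k ∈ c.support, (1 / 2 : ℝ) ^ k := by
        rw [Finset.mul_sum]; simp only [mul_assoc]
    _ ≤ ‖y‖ * (1 / 2 : ℝ) ^ (n + 2) * 2 := by gcongr
    _ = _ := by ring

variable {a : Ordinal.{0} → ℕ → Ordinal.{0}} {α : Ordinal.{0}}

/-- If admissible sequences of blocks of `(z_i)` can be moved slightly to become admissible
sequences of blocks of `(x_i)` with respect to `(x_i)`, then `δ_α((z_i), (e_i))` is not much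
smaller than `δ_α(x_i)`. -/
theorem delta_sub_le_deltaRel (ha : IsFundamentalSystem a) (hα : α < Ordinal.omega 1)
    {e x w : ℕ → X} (hw : IsBlockBasis e w) (hx : ∀ i, x i ≠ 0) {η : ℝ} (hη0 : 0 ≤ η)
    (h : ∀ (ℓ : ℕ) (y : Fin ℓ → X), IsFiniteBlockBasis w y → IsAdmissible a α e y →
      ∃ y' : Fin ℓ → X, IsFiniteBlockBasis x y' ∧ IsAdmissible a α x y' ∧
        ∀ i, ‖y i - y' i‖ ≤ η * ‖y i‖) :
    delta a α x - 2 * η ≤ deltaRel a α w e := by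
  refine le_deltaRel ha hα hw fun ℓ y hy hya => ?_
  obtain ⟨y', hy', hya', hyy'⟩ := h ℓ y hy hya
  have hδ1 := delta_le_one ha hα hx
  have hδ0 : 0 ≤ delta a α x := deltaRel_nonneg
  have h1 : delta a α x * ∑ i, ‖y' i‖ ≤ ‖∑ i, y' i‖ := deltaRel_mul_le hy' hya'
  have h2 : ‖∑ i, y' i‖ ≤ ‖∑ i, y i‖ + η * ∑ i, ‖y i‖ := by
    calc ‖∑ i, y' i‖ = ‖∑ i, y i - ∑ i, (y i - y' i)‖ := by
          rw [Finset.sum_sub_distrib, sub_sub_cancel]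
      _ ≤ ‖∑ i, y i‖ + ‖∑ i, (y i - y' i)‖ := norm_sub_le _ _
      _ ≤ ‖∑ i, y i‖ + ∑ i, η * ‖y i‖ := by
          gcongr
          exact (norm_sum_le _ _).trans (Finset.sum_le_sum fun i _ => hyy' i)
      _ = _ := by rw [Finset.mul_sum]
  have h3 : (1 - η) * ∑ i, ‖y i‖ ≤ ∑ i, ‖y' i‖ := by
    rw [Finset.mul_sum]
    refine Finset.sum_le_sum fun i _ => ?_
    have := norm_sub_norm_le (y i) (y' i)
    have := hyy' i
    linarith
  have h4 : 0 ≤ ∑ i, ‖y i‖ := Finset.sum_nonneg fun _ _ => norm_nonneg _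
  have h5 := mul_le_mul_of_nonneg_left h3 hδ0
  -- One η is lost in comparing ‖∑ y'‖ with ‖∑ y‖; the second, from ∑ ‖y'‖, carries the factor δ ≤
  -- 1.
  have h6 := mul_le_mul_of_nonneg_right hδ1 (mul_nonneg hη0 h4)
  linarith

/-- Every block basis `(x_i)` of `(e_i)` has a block basis `(z_i)` for whose blocks the frame
`(e_i)` is, up to small errors, as good as the frame `(x_i)`. -/
theorem IsBlockBasis.exists_block_delta_le {e : SchauderBasis ℝ X} (ha : IsFundamentalSystem a)
    {x : ℕ → X} (hx : IsBlockBasis e x) :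
    ∃ z : ℕ → X, IsBlockBasis x z ∧ ∀ (n : ℕ) (w : ℕ → X),
      IsBlockBasis (fun i => z (n + i)) w → ∀ α < Ordinal.omega 1,
        delta a α (fun i => x (n + i)) - (1 / 2 : ℝ) ^ n ≤ deltaRel a α w e := by
  obtain ⟨f, hf⟩ := hx.exists_biorthogonal
  obtain ⟨m, B, hB, hBx⟩ := isBlockBasis_iff.1 hx
  have hBne : ∀ k, (B k).support.Nonempty := fun k => Finsupp.support_nonempty_iff.2 fun h =>
    (hBx k).2 (by rw [(hBx k).1, h, map_zero])
  -- Here u (k + 1) = J k + 1 for the J below. In J, the term m (u k + 1) bounds the `e`-support of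
  -- x (u k), and the summand k absorbs the index shift when the first n terms are dropped.
  obtain ⟨u, hu⟩ : ∃ u : ℕ → ℕ, ∀ k, u (k + 1) = k + u k + m (u k + 1) + 2 :=
    ⟨fun k => Nat.rec 0 (fun k r => k + r + m (r + 1) + 2) k, fun k => rfl⟩
  have hum : StrictMono u := strictMono_nat_of_lt_succ fun k => by rw [hu]; omega
  obtain ⟨J, hJ⟩ : ∃ J : ℕ → ℕ, ∀ k, J k = k + u k + m (u k + 1) + 1 := ⟨_, fun k => rfl⟩
  have hJu : ∀ k, J k ∈ Finset.Ico (u k) (u (k + 1)) := fun k => by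
    rw [Finset.mem_Ico, hu, hJ]; omega
  have huu : ∀ k, u k ∈ Finset.Ico (u k) (u (k + 1)) := fun k => by
    rw [Finset.mem_Ico, hu]; omega
  -- The functionals f (J k) are biorthogonal to z, so this makes z k and x (J k) close enough for
  -- `norm_linearCombination_sub_le`.
  obtain ⟨s, hs0, hs⟩ : ∃ s : ℕ → ℝ, (∀ k, 0 < s k) ∧
      ∀ k, ‖f (J k)‖ * (s k * ‖x (u k)‖) ≤ (1 / 2 : ℝ) ^ (k + 2) := by
    refine ⟨fun k => (1 / 2 : ℝ) ^ (k + 2) / (1 + ‖f (J k)‖ * ‖x (u k)‖),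
      fun k => by positivity, fun k => ?_⟩
    rw [show ‖f (J k)‖ * ((1 / 2 : ℝ) ^ (k + 2) / (1 + ‖f (J k)‖ * ‖x (u k)‖) * ‖x (u k)‖) =
      (1 / 2 : ℝ) ^ (k + 2) * ((‖f (J k)‖ * ‖x (u k)‖) / (1 + ‖f (J k)‖ * ‖x (u k)‖)) by ring]
    refine mul_le_of_le_one_right (by positivity) (div_le_one_of_le₀ (by linarith) (by positivity))
  have hJne : ∀ k k', J k ≠ u k' := fun k k' h => by
    have := Ico_unique hum (hJu k) (h.symm ▸ huu k' : J k ∈ Finset.Ico (u k') (u (k' + 1)))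
    subst this
    have := hJ k
    omega
  have hJinj : ∀ k k', J k = J k' → k = k' := fun k k' h =>
    Ico_unique hum (hJu k) (h ▸ hJu k')
  set D : ℕ → ℕ →₀ ℝ := fun k => Finsupp.single (u k) (s k) + Finsupp.single (J k) 1 with hD
  have hDu : ∀ k, u k ∈ (D k).support := fun k => by
    simp [hD, hJne, (hs0 k).ne']
  have hDs : ∀ k, (D k).support ⊆ Finset.Ico (u k) (u (k + 1)) := fun k r hr => by
    rcases Finset.mem_union.1 (Finsupp.support_add hr) with h | h
    · rw [Finset.mem_singleton.1 (Finsupp.support_single_subset h)]; exact huu k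
    · rw [Finset.mem_singleton.1 (Finsupp.support_single_subset h)]; exact hJu k
  have hDB : IsBlockCoeff u D := ⟨hum, hDs⟩
  set z : ℕ → X := fun k => s k • x (u k) + x (J k) with hz
  have hzD : ∀ k, z k = Finsupp.linearCombination ℝ x (D k) := fun k => by simp [hz, hD]
  have hfz : ∀ k k', f (J k) (z k') = if k = k' then 1 else 0 := fun k k' => by
    have hiff : J k = J k' ↔ k = k' := ⟨hJinj k k', fun h => h ▸ rfl⟩
    simp [hz, hf, hJne, hiff]
  have hz0 : ∀ k, z k ≠ 0 := fun k h => by simpa [h] using hfz k k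
  have hxz : IsBlockBasis x z := isBlockBasis_iff.2 ⟨u, D, hDB, fun k => ⟨hzD k, hz0 k⟩⟩
  refine ⟨z, hxz, fun n w hw α hα => ?_⟩
  have hxzn : IsBlockBasis x fun i => z (n + i) := hxz.trans (isBlockBasis_tail hz0 n)
  have hew : IsBlockBasis e w := (hx.trans hxzn).trans hw
  rw [show (1 / 2 : ℝ) ^ n = 2 * (1 / 2 : ℝ) ^ (n + 1) by ring]
  refine delta_sub_le_deltaRel ha hα hew (fun i => hx.ne_zero _) (by positivity)
    fun ℓ y hy hya => ?_
  obtain ⟨p, c, hp, hc, hyc⟩ := isFiniteBlockBasis_iff.1 (hy.of_isBlockBasis hw)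
  obtain ⟨c', hc', hadm⟩ := hya
  have hnJ : ∀ k, n ≤ J (n + k) := fun k => by rw [hJ]; omega
  -- the vectors `x (J (n + k))` as blocks of the tail `x (n + ·)`
  have hC : IsBlockCoeff (fun k => u (n + k) - n)
      fun k => Finsupp.single (J (n + k) - n) (1 : ℝ) := by
    refine ⟨fun i j hij => ?_, fun k r hr => ?_⟩
    · have h1 := hum (Nat.add_lt_add_left hij n)
      have h2 := (Nat.le_add_right n i).trans (hum.id_le (n + i))
      show u (n + i) - n < u (n + j) - n
      omega
    · rw [Finset.mem_singleton.1 (Finsupp.support_single_subset hr)]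
      have h1 := Finset.mem_Ico.1 (hJu (n + k))
      have h2 := (Nat.le_add_right n k).trans (hum.id_le (n + k))
      rw [Finset.mem_Ico]
      show u (n + k) - n ≤ J (n + k) - n ∧ J (n + k) - n < u (n + k + 1) - n
      omega
  have hv : ∀ k, x (J (n + k)) = Finsupp.linearCombination ℝ (fun i => x (n + i))
      (Finsupp.single (J (n + k) - n) (1 : ℝ)) := fun k => by
    simp [Nat.add_sub_cancel' (hnJ k)]
  have hpert : ∀ i, ‖y i - Finsupp.linearCombination ℝ (fun k => x (J (n + k))) (c i)‖ ≤
      (1 / 2 : ℝ) ^ (n + 1) * ‖y i‖ := fun i => by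
    rw [(hyc i).1]
    refine norm_linearCombination_sub_le (g := fun k => f (J (n + k)))
      (fun k j => by simp [hfz]) (fun k => ?_) (c i)
    have : z (n + k) - x (J (n + k)) = s (n + k) • x (u (n + k)) := by simp [hz]
    rw [this, norm_smul, Real.norm_of_nonneg (hs0 _).le]
    exact (hs (n + k)).trans_eq (by ring)
  have hne : ∀ i, Finsupp.linearCombination ℝ (fun k => x (J (n + k))) (c i) ≠ 0 := fun i h => by
    have h1 := hpert i
    rw [h, sub_zero] at h1
    have h2 := norm_pos_iff.2 (hyc i).2
    have h3 : (1 / 2 : ℝ) ^ (n + 1) < 1 := pow_lt_one₀ (by norm_num) (by norm_num) (by omega)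
    nlinarith
  have hlin : ∀ i, Finsupp.linearCombination ℝ (fun k => x (J (n + k))) (c i) =
      Finsupp.linearCombination ℝ (fun i => x (n + i)) (Finsupp.linearCombination ℝ
        (fun k => Finsupp.single (J (n + k) - n) (1 : ℝ)) (c i)) := fun i =>
    linearCombination_blocks hv (c i)
  refine ⟨fun i => Finsupp.linearCombination ℝ (fun k => x (J (n + k))) (c i), ?_, ?_, hpert⟩
  · exact isFiniteBlockBasis_iff.2 ⟨_, _, hC.1.comp hp, fun i => hC.support_subset (hc i),
      fun i => ⟨hlin i, hne i⟩⟩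
  · refine ⟨_, hlin, hadm.of_dominated (fun i h => hne i (by rw [hlin, h, map_zero])) ?_ ?_⟩
    · intro i j hij q hq r hr
      have h1 := Finset.mem_Ico.1 (hC.support_subset (hc i) hq)
      have h2 := Finset.mem_Ico.1 (hC.support_subset (hc j) hr)
      exact (h1.2.trans_le (hC.1.monotone (fin_succ_le_castSucc hp hij))).trans_le h2.1
    · intro i q hq
      obtain ⟨k, hk, hqk⟩ := (hC.mem_support_iff _ _).1 hq
      have hq' := Finset.mem_singleton.1 (Finsupp.support_single_subset hqk)
      have hDn : IsBlockCoeff (fun k => u (n + k)) fun k => D (n + k) :=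
        ⟨fun i j hij => hum (Nat.add_lt_add_left hij n), fun k => hDs (n + k)⟩
      obtain ⟨r, hr⟩ := hBne (u (n + k))
      -- Admissibility supplies some coefficients c'; independence of `e` identifies them with those
      -- computed through z and x.
      have hcc : c' i = Finsupp.linearCombination ℝ B
          (Finsupp.linearCombination ℝ (fun k => D (n + k)) (c i)) := by
        refine e.linearIndependent ?_
        rw [← hc' i, (hyc i).1, linearCombination_blocks (fun k => hzD (n + k)),
          linearCombination_blocks (fun k => (hBx k).1)]
      refine ⟨r, ?_, ?_⟩
      · rw [hcc]
        exact (hB.mem_support_iff _ _).2 ⟨u (n + k),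
          (hDn.mem_support_iff _ _).2 ⟨k, hk, hDu (n + k)⟩, hr⟩
      -- r < m (u (n + k) + 1) ≤ J (n + k) - n = q.
      · have := Finset.mem_Ico.1 (hB.2 _ hr)
        have := hJ (n + k)
        omega

theorem antitone_tendsto_add_geometric {ε : ℕ → ℝ} (hε : Antitone ε)
    (hε0 : Filter.Tendsto ε Filter.atTop (nhds 0)) :
    Antitone (fun n => ε n + (1 / 2 : ℝ) ^ n) ∧
      Filter.Tendsto (fun n => ε n + (1 / 2 : ℝ) ^ n) Filter.atTop (nhds 0) := by
  refine ⟨fun i j h => add_le_add (hε h)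
    (pow_le_pow_of_le_one (by norm_num) (by norm_num) h), ?_⟩
  simpa using hε0.add (tendsto_pow_atTop_nhds_zero_of_lt_one
    (by norm_num : (0 : ℝ) ≤ 1 / 2) (by norm_num))

/-- A block basis that stabilizes with respect to the basis stabilizes with respect to itself. -/
theorem StabilizesRel.stabilizes {e : SchauderBasis ℝ X} (ha : IsFundamentalSystem a)
    {x : ℕ → X} {γ : Set.Iio (Ordinal.omega 1 : Ordinal.{0}) → ℝ} (h : StabilizesRel a e x γ) :
    Stabilizes a x γ := by
  obtain ⟨hx, ε, hε, hε0, h⟩ := h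
  obtain ⟨hε', hε0'⟩ := antitone_tendsto_add_geometric hε hε0
  refine ⟨_, hε', hε0', fun α => ?_⟩
  obtain ⟨m, hm⟩ := h α
  refine ⟨m, fun n hn w hw => ?_⟩
  have hew : IsBlockBasis e w := (hx.trans (isBlockBasis_tail hx.ne_zero n)).trans hw
  have hlow := deltaRel_le_delta ha α.2 hew
  obtain ⟨z, hz, hzδ⟩ := hew.exists_block_delta_le ha
  -- For every k, δ(w) ≤ δ(tail of w) ≤ δ(tail of z, e) + 2⁻ᵏ < γ + ε n + 2⁻ᵏ.
  have hup : delta a α w ≤ γ α + ε n := by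
    refine le_of_forall_pos_le_add fun r hr => ?_
    obtain ⟨k, hk⟩ := exists_pow_lt_of_lt_one hr (by norm_num : (1 / 2 : ℝ) < 1)
    have h1 := hzδ k _ (isBlockBasis_self fun i => hz.ne_zero (k + i)) α α.2
    have h2 := delta_mono ha α.2 (isBlockBasis_tail hw.ne_zero k)
    have h3 := abs_lt.1 (hm n hn _ ((hw.trans hz).trans (isBlockBasis_tail hz.ne_zero k)))
    linarith
  have := abs_lt.1 (hm n hn w hw)
  have hpos : (0 : ℝ) < (1 / 2) ^ n := by positivity
  rw [abs_lt]
  constructor <;> linarith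

/-- A block basis that stabilizes with respect to itself has a block basis that stabilizes with
respect to the basis. -/
theorem Stabilizes.exists_stabilizesRel {e : SchauderBasis ℝ X} (ha : IsFundamentalSystem a)
    {x : ℕ → X} (hx : IsBlockBasis e x) {γ : Set.Iio (Ordinal.omega 1 : Ordinal.{0}) → ℝ}
    (h : Stabilizes a x γ) : ∃ z, StabilizesRel a e z γ := by
  obtain ⟨ε, hε, hε0, h⟩ := h
  obtain ⟨hε', hε0'⟩ := antitone_tendsto_add_geometric hε hε0
  obtain ⟨z, hz, hzδ⟩ := hx.exists_block_delta_le ha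
  refine ⟨z, hx.trans hz, _, hε', hε0', fun α => ?_⟩
  obtain ⟨m, hm⟩ := h α
  refine ⟨m, fun n hn w hw => ?_⟩
  have hew : IsBlockBasis e w :=
    ((hx.trans hz).trans (isBlockBasis_tail hz.ne_zero n)).trans hw
  have h1 := hzδ n w hw α α.2
  have h2 := deltaRel_le_delta ha α.2 hew
  -- The tail of x, fed into h1, gives the lower bound; w, as a block basis of that tail, gives the
  -- upper one.
  have h3 := abs_lt.1 (hm n hn _ (isBlockBasis_self fun i => hx.ne_zero (n + i)))
  have h4 := abs_lt.1 (hm n hn w ((hz.tail n).trans hw))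
  have hpos : (0 : ℝ) < (1 / 2) ^ n := by positivity
  rw [abs_lt]
  constructor <;> linarith

/-- Each tail of x is a block basis of itself, so γ α is the limit of δ_α along the tails. -/
theorem Stabilizes.unique {x : ℕ → X} (hx : ∀ i, x i ≠ 0)
    {γ γ' : Set.Iio (Ordinal.omega 1 : Ordinal.{0}) → ℝ} (h : Stabilizes a x γ)
    (h' : Stabilizes a x γ') : γ = γ' := by
  obtain ⟨ε, -, hε0, h⟩ := h
  obtain ⟨ε', -, hε0', h'⟩ := h'
  funext α
  have key : ∀ {ε : ℕ → ℝ} {γ : Set.Iio (Ordinal.omega 1 : Ordinal.{0}) → ℝ},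
      Filter.Tendsto ε Filter.atTop (nhds 0) →
      (∃ m : ℕ, ∀ n ≥ m, ∀ z : ℕ → X,
        IsBlockBasis (fun i => x (n + i)) z → |delta a α z - γ α| < ε n) →
      Filter.Tendsto (fun n => delta a α fun i => x (n + i)) Filter.atTop (nhds (γ α)) := by
    rintro ε γ hε ⟨m, hm⟩
    rw [tendsto_iff_dist_tendsto_zero]
    refine squeeze_zero' (Filter.Eventually.of_forall fun _ => dist_nonneg)
      (Filter.eventually_atTop.2 ⟨m, fun n hn => ?_⟩) hε
    rw [Real.dist_eq]
    exact (hm n hn _ (isBlockBasis_self fun i => hx (n + i))).le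
  exact tendsto_nhds_unique (key hε0 (h α)) (key hε0' (h' α))

end Perturbation

end DeltaSpectra

theorem theoremT {X : Type*} [NormedAddCommGroup X] [NormedSpace ℝ X] [CompleteSpace X]
    (e : SchauderBasis ℝ X)
    (a : Ordinal.{0} → ℕ → Ordinal.{0}) (ha : DeltaSpectra.IsFundamentalSystem a) :
    (∀ (x : ℕ → X) (γbar γ : Set.Iio (Ordinal.omega 1 : Ordinal.{0}) → ℝ),
        DeltaSpectra.IsBlockBasis e x →
        DeltaSpectra.StabilizesRel a e x γbar →
        DeltaSpectra.Stabilizes a x γ →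
        γbar = γ) ∧
      DeltaSpectra.spectrum a e = DeltaSpectra.spectrumRel a e := by
  refine ⟨fun x γbar γ hx h h' => (h.stabilizes ha).unique hx.ne_zero h', Set.ext fun γ => ⟨?_, ?_⟩⟩
  · rintro ⟨y, hy, h⟩
    exact h.exists_stabilizesRel ha hy
  · rintro ⟨y, h⟩
    exact ⟨y, h.1, h.stabilizes ha⟩
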